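/- Let $M$ be a closed manifold (compact, Hausdorff, without boundary, of any dimension $n\ge 0$, not necessarily connected), and let $C(M)$ be the algebra of continuous real-valued functions on $M$. For $H\in C(M)$ let $C(H)=\{\varphi\circ H : \varphi\in C(\operatorname{im}H)\}$ be the closed subalgebra generated by $H$ and $1$. A quasi-state on $M$ is a functional $\zeta\colon C(M)\to\mathbb R$ such that $\zeta(H)\ge 0$ for $H\ge 0$, $\zeta$ is linear on $C(H)$ for every $H\in C(M)$, and $\zeta(1)=1$; it is simple if moreover it is multiplicative on $C(H)$ for every $H\in C(M)$. Let $\zeta$ be a simple quasi-state on $M$, let $F,G\in C(M)$, and put $\Pi(F,G)=|\zeta(F+G)-\zeta(F)-\zeta(G)|$. Then the image of the map $\Phi\colon M\to\mathbb R^2$, $\Phi(x)=(F(x),G(x))$, contains the convex hull of the three points $$P=(\zeta(F),\zeta(G)),\quad Q=(\zeta(F),\zeta(F+G)-\zeta(F)),\quad R=(\zeta(F+G)-\zeta(G),\zeta(G)).$$ This convex hull is an isosceles right triangle with right angle at $P$, whose legs $PQ$ and $PR$ have length $\Pi(F,G)$ (it degenerates to the single point $P$ if $\Pi(F,G)=0$).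 -/

import Mathlib

open scoped EuclideanGeometry

/-- The closed subalgebra `C(F)` of `C(X)` generated by `F` and `1`, that is, the set of all
`φ ∘ F` with `φ` a continuous real function on the image of `F`. -/
def singlyGenerated {X : Type*} [TopologicalSpace X] (F : C(X, ℝ)) : Set C(X, ℝ) :=
  {A | ∃ φ : C(Set.range F, ℝ), ∀ x, A x = φ ⟨F x, Set.mem_range_self x⟩}

/-- Quasi-states: positive normalized functionals that are linear on each `C(F)`. -/
structure IsQuasiState {X : Type*} [TopologicalSpace X] (ζ : C(X, ℝ) → ℝ) : Prop where
  nonneg : ∀ F : C(X, ℝ), 0 ≤ F → 0 ≤ ζ F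
  linear : ∀ F : C(X, ℝ), ∀ A ∈ singlyGenerated F, ∀ B ∈ singlyGenerated F, ∀ a b : ℝ,
    ζ (a • A + b • B) = a * ζ A + b * ζ B
  map_one : ζ 1 = 1

/-- Simple quasi-states: those that are multiplicative on each `C(F)`. -/
structure IsSimpleQuasiState {X : Type*} [TopologicalSpace X] (ζ : C(X, ℝ) → ℝ) : Prop
    extends IsQuasiState ζ where
  map_mul : ∀ F : C(X, ℝ), ∀ A ∈ singlyGenerated F, ∀ B ∈ singlyGenerated F,
    ζ (A * B) = ζ A * ζ B

/-- The extent of nonlinearity `Π(F, G) = |ζ(F + G) - ζ(F) - ζ(G)|`. -/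
def nonlinearity {X : Type*} [TopologicalSpace X] (ζ : C(X, ℝ) → ℝ) (F G : C(X, ℝ)) : ℝ :=
  |ζ (F + G) - ζ F - ζ G|

/-- The map `Φ = (F, G)` into the Euclidean plane. -/
def momentMap {X : Type*} [TopologicalSpace X] (F G : C(X, ℝ)) (x : X) :
    EuclideanSpace ℝ (Fin 2) :=
  !₂[F x, G x]

/-! Simplicity gives `ζ (φ ∘ H) = φ (ζ H)`, so `ζ` acts through the level sets `{H = ζ H}`. Any two
of these meet (`exists_eq_and_eq`), and if `l` has no zero on one of them, one of its two sign
pieces contains another (`exists_level_subset`). Hence three functions with zero sum and positive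
values under `ζ` vanish together: otherwise some level set would lie where one of them is negative,
yet it must meet the level set of that function. A perturbation allows zero values, and affine
functions of `F`, `G`, `F + G` then give each point of the triangle. Only compactness of `M`
matters. -/

lemma exists_pos_le_of_pos {X : Type*} [TopologicalSpace X] [CompactSpace X] (f : C(X, ℝ))
    (hf : ∀ x, 0 < f x) : ∃ ε > 0, ∀ x, ε ≤ f x := by
  rcases isEmpty_or_nonempty X with hX | hX
  · exact ⟨1, one_pos, fun x => (hX.false x).elim⟩
  · obtain ⟨x, -, hx⟩ := isCompact_univ.exists_isMinOn Set.univ_nonempty f.continuous.continuousOn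
    exact ⟨f x, hf x, fun y => hx (Set.mem_univ y)⟩

lemma comp_mem_singlyGenerated {X : Type*} [TopologicalSpace X] (φ : C(ℝ, ℝ)) (H : C(X, ℝ)) :
    φ.comp H ∈ singlyGenerated H :=
  ⟨φ.comp ⟨Subtype.val, continuous_subtype_val⟩, fun _ => rfl⟩

namespace IsSimpleQuasiState

variable {X : Type*} [TopologicalSpace X] {ζ : C(X, ℝ) → ℝ}

lemma map_linear_comp (hζ : IsSimpleQuasiState ζ) (H : C(X, ℝ)) (φ ψ : C(ℝ, ℝ)) (a b : ℝ) :
    ζ ((a • φ + b • ψ).comp H) = a * ζ (φ.comp H) + b * ζ (ψ.comp H) :=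
  hζ.linear H _ (comp_mem_singlyGenerated φ H) _ (comp_mem_singlyGenerated ψ H) a b

lemma map_mul_comp (hζ : IsSimpleQuasiState ζ) (H : C(X, ℝ)) (φ ψ : C(ℝ, ℝ)) :
    ζ ((φ * ψ).comp H) = ζ (φ.comp H) * ζ (ψ.comp H) :=
  hζ.map_mul H _ (comp_mem_singlyGenerated φ H) _ (comp_mem_singlyGenerated ψ H)

/-- With `ζ` read as an expectation on `C(H)`, multiplicativity makes every variance vanish. -/
lemma map_sub_const_sq_comp (hζ : IsSimpleQuasiState ζ) (H : C(X, ℝ)) (φ : C(ℝ, ℝ)) :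
    ζ (((φ - ContinuousMap.const ℝ (ζ (φ.comp H))) *
      (φ - ContinuousMap.const ℝ (ζ (φ.comp H)))).comp H) = 0 := by
  have h1 : ζ ((1 : C(ℝ, ℝ)).comp H) = 1 := hζ.map_one
  have h : φ - ContinuousMap.const ℝ (ζ (φ.comp H)) =
      (1 : ℝ) • φ + (-ζ (φ.comp H)) • (1 : C(ℝ, ℝ)) := by
    ext x; simp [sub_eq_add_neg]
  rw [hζ.map_mul_comp, h, hζ.map_linear_comp, h1]
  ring

/-- A simple quasi-state restricts to an evaluation on each singly generated subalgebra. -/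
lemma map_comp [CompactSpace X] (hζ : IsSimpleQuasiState ζ) (φ : C(ℝ, ℝ)) (H : C(X, ℝ)) :
    ζ (φ.comp H) = φ (ζ H) := by
  by_contra hne
  set A : C(ℝ, ℝ) := (φ - ContinuousMap.const ℝ (ζ (φ.comp H))) *
    (φ - ContinuousMap.const ℝ (ζ (φ.comp H))) with hA
  set B : C(ℝ, ℝ) := (.id ℝ - ContinuousMap.const ℝ (ζ ((ContinuousMap.id ℝ).comp H))) *
    (.id ℝ - ContinuousMap.const ℝ (ζ ((ContinuousMap.id ℝ).comp H))) with hB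
  -- The two variances add up to zero, but if the claim fails their integrands have no common zero,
  -- so by compactness the sum is at least some `ε > 0`.
  have hAB : ζ (((1 : ℝ) • A + (1 : ℝ) • B).comp H) = 0 := by
    rw [hζ.map_linear_comp, hA, hB, hζ.map_sub_const_sq_comp, hζ.map_sub_const_sq_comp]
    ring
  have hval : ∀ x, (((1 : ℝ) • A + (1 : ℝ) • B).comp H) x =
      (φ (H x) - ζ (φ.comp H)) ^ 2 + (H x - ζ H) ^ 2 := by
    intro x
    simp [hA, hB, ContinuousMap.id_comp]
    ring
  obtain ⟨ε, hε, hle⟩ := exists_pos_le_of_pos (((1 : ℝ) • A + (1 : ℝ) • B).comp H) (by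
    intro x
    rw [hval]
    by_cases h : H x = ζ H
    · have : φ (H x) - ζ (φ.comp H) ≠ 0 := by
        rw [h]; exact fun h' => hne (by linarith)
      positivity
    · have : H x - ζ H ≠ 0 := sub_ne_zero.2 h
      positivity)
  have h1 : ζ ((1 : C(ℝ, ℝ)).comp H) = 1 := hζ.map_one
  have hnn := hζ.nonneg (((1 : ℝ) • ((1 : ℝ) • A + (1 : ℝ) • B) + (-ε) • (1 : C(ℝ, ℝ))).comp H) (by
    intro x
    have := hle x
    simp at this ⊢
    linarith)
  rw [hζ.map_linear_comp, hAB, h1] at hnn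
  linarith

lemma map_eq_of_comp [CompactSpace X] (hζ : IsSimpleQuasiState ζ) {A H : C(X, ℝ)} {φ : ℝ → ℝ}
    (hφ : Continuous φ) (h : ∀ x, A x = φ (H x)) : ζ A = φ (ζ H) := by
  have hA : A = (⟨φ, hφ⟩ : C(ℝ, ℝ)).comp H := by ext x; exact h x
  rw [hA, hζ.map_comp]
  rfl

/-- The level sets `{F = ζ F}` and `{G = ζ G}` intersect. -/
lemma exists_eq_and_eq [CompactSpace X] (hζ : IsSimpleQuasiState ζ) (F G : C(X, ℝ)) :
    ∃ x, F x = ζ F ∧ G x = ζ G := by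
  by_contra! hne
  obtain ⟨ε, hε, hle⟩ := exists_pos_le_of_pos
    (⟨fun x => |F x - ζ F| + |G x - ζ G|, by fun_prop⟩ : C(X, ℝ)) (by
      intro x
      show 0 < |F x - ζ F| + |G x - ζ G|
      by_cases h : F x = ζ F
      · have : G x - ζ G ≠ 0 := sub_ne_zero.2 (hne x h)
        positivity
      · have : F x - ζ F ≠ 0 := sub_ne_zero.2 h
        positivity)
  replace hle : ∀ x, ε ≤ |F x - ζ F| + |G x - ζ G| := hle
  -- By `hle` these two bumps are never positive at the same point.
  let f : C(X, ℝ) := ⟨fun x => max (ε - 2 * |F x - ζ F|) 0, by fun_prop⟩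
  let g : C(X, ℝ) := ⟨fun x => max (ε - 2 * |G x - ζ G|) 0, by fun_prop⟩
  have hf : ζ f = ε := by
    rw [hζ.map_eq_of_comp (A := f) (H := F) (φ := fun t => max (ε - 2 * |t - ζ F|) 0)
      (by fun_prop) fun x => rfl]
    simp [hε.le]
  have hg : ζ g = ε := by
    rw [hζ.map_eq_of_comp (A := g) (H := G) (φ := fun t => max (ε - 2 * |t - ζ G|) 0)
      (by fun_prop) fun x => rfl]
    simp [hε.le]
  have hfg : ∀ x, f x = 0 ∧ 0 ≤ g x ∨ g x = 0 ∧ 0 ≤ f x := by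
    intro x
    rcases le_total (ε - 2 * |F x - ζ F|) 0 with h | h
    · exact .inl ⟨max_eq_right h, le_max_right _ _⟩
    · exact .inr ⟨max_eq_right (by linarith [hle x]), le_max_right _ _⟩
  -- `f` and `g` are the positive and negative parts of `f - g`, so `ζ` must kill one of them.
  have hf' : ζ f = max (ζ (f - g)) 0 :=
    hζ.map_eq_of_comp (φ := fun t => max t 0) (by fun_prop) fun x => by
      rcases hfg x with ⟨h, h'⟩ | ⟨h, h'⟩ <;> simp [h, h']
  have hg' : ζ g = max (-ζ (f - g)) 0 :=
    hζ.map_eq_of_comp (φ := fun t => max (-t) 0) (by fun_prop) fun x => by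
      rcases hfg x with ⟨h, h'⟩ | ⟨h, h'⟩ <;> simp [h, h']
  rcases le_total (ζ (f - g)) 0 with h | h
  · rw [max_eq_right h] at hf'; linarith
  · rw [max_eq_right (neg_nonpos.2 h)] at hg'; linarith

/-- If `l` has no zero on the level set `{k = ζ k}`, then one of the two pieces into which the
sign of `l` cuts this level set contains a level set of the same kind. -/
lemma exists_level_subset [CompactSpace X] (hζ : IsSimpleQuasiState ζ) (k l : C(X, ℝ))
    (hkl : ∀ x, k x = ζ k → l x ≠ 0) :
    ∃ g : C(X, ℝ), (∀ x, g x = ζ g → k x = ζ k ∧ 0 < l x) ∨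
      (∀ x, g x = ζ g → k x = ζ k ∧ l x < 0) := by
  obtain ⟨ε, hε, hle⟩ := exists_pos_le_of_pos
    (⟨fun x => |k x - ζ k| + |l x|, by fun_prop⟩ : C(X, ℝ)) (by
      intro x
      show 0 < |k x - ζ k| + |l x|
      by_cases h : k x = ζ k
      · have := hkl x h
        positivity
      · have : k x - ζ k ≠ 0 := sub_ne_zero.2 h
        positivity)
  replace hle : ∀ x, ε ≤ |k x - ζ k| + |l x| := hle
  let f : C(X, ℝ) := ⟨fun x => max (ε - 2 * |k x - ζ k|) 0, by fun_prop⟩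
  -- A clipped sign of `l`: it is exactly `±ε` wherever the bump `f` is positive.
  let s : C(X, ℝ) := ⟨fun x => max (-ε) (min ε (2 * l x)), by fun_prop⟩
  have hf : ζ f = ε := by
    rw [hζ.map_eq_of_comp (A := f) (H := k) (φ := fun t => max (ε - 2 * |t - ζ k|) 0)
      (by fun_prop) fun x => rfl]
    simp [hε.le]
  have hfx : ∀ x, f x = max (ε - 2 * |k x - ζ k|) 0 := fun _ => rfl
  have hsx : ∀ x, s x = max (-ε) (min ε (2 * l x)) := fun _ => rfl
  have hpos : ∀ x, f x = 0 ∨ 0 < f x ∧ (s x = ε ∧ 0 < l x ∨ s x = -ε ∧ l x < 0) := by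
    intro x
    rcases le_or_gt (ε - 2 * |k x - ζ k|) 0 with h | h
    · exact .inl (max_eq_right h)
    · refine .inr ⟨h.trans_le (le_max_left _ _), ?_⟩
      have h1 := hle x
      rw [hsx]
      rcases abs_cases (l x) with ⟨h2, h3⟩ | ⟨h2, h3⟩
      · left
        rw [min_eq_left (by linarith), max_eq_right (by linarith)]
        exact ⟨rfl, by linarith⟩
      · right
        rw [min_eq_right (by linarith), max_eq_left (by linarith)]
        exact ⟨rfl, by linarith⟩
  have hfe : ∀ x, f x = ε → k x = ζ k := by
    intro x hx
    rw [hfx] at hx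
    have h0 := abs_nonneg (k x - ζ k)
    rcases max_choice (ε - 2 * |k x - ζ k|) 0 with h | h
    · exact sub_eq_zero.1 (abs_eq_zero.1 (by linarith))
    · linarith
  -- Since `ε f = |f s|` pointwise, `ζ (f * s) = ±ε²`; this level forces `f = ε` and fixes the sign
  -- of `l`.
  have habs : ε * ζ f = |ζ (f * s)| := by
    have h : ζ f = ε⁻¹ * |ζ (f * s)| :=
      hζ.map_eq_of_comp (φ := fun t => ε⁻¹ * |t|) (by fun_prop) fun x => by
        rcases hpos x with h | ⟨h, ⟨h', -⟩ | ⟨h', -⟩⟩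
        · simp [h]
        · rw [ContinuousMap.mul_apply, h', abs_of_pos (by positivity)]
          field_simp
        · rw [ContinuousMap.mul_apply, h', mul_neg, abs_neg, abs_of_pos (by positivity)]
          field_simp
    rw [h]; field_simp
  rw [hf] at habs
  refine ⟨f * s, ?_⟩
  rcases abs_cases (ζ (f * s)) with ⟨h, -⟩ | ⟨h, -⟩
  · left
    intro x hx
    rw [ContinuousMap.mul_apply] at hx
    have hee : 0 < ε * ε := by positivity
    rcases hpos x with h0 | ⟨h0, ⟨h1, h2⟩ | ⟨h1, h2⟩⟩
    · rw [h0] at hx; linarith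
    · rw [h1] at hx
      exact ⟨hfe x (mul_right_cancel₀ hε.ne' (by linarith)), h2⟩
    · rw [h1] at hx
      nlinarith
  · right
    intro x hx
    rw [ContinuousMap.mul_apply] at hx
    have hee : 0 < ε * ε := by positivity
    rcases hpos x with h0 | ⟨h0, ⟨h1, h2⟩ | ⟨h1, h2⟩⟩
    · rw [h0] at hx; linarith
    · rw [h1] at hx
      nlinarith
    · rw [h1] at hx
      exact ⟨hfe x (mul_right_cancel₀ hε.ne' (by linarith)), h2⟩

/-- Three functions with sum zero and positive quasi-integrals have a common zero. -/
lemma exists_common_zero_of_pos [CompactSpace X] (hζ : IsSimpleQuasiState ζ) (f g h : C(X, ℝ))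
    (hsum : ∀ x, f x + g x + h x = 0) (hf : 0 < ζ f) (hg : 0 < ζ g) (hh : 0 < ζ h) :
    ∃ x, f x = 0 ∧ g x = 0 ∧ h x = 0 := by
  by_contra! hne
  have hN : ∀ x, 0 < |f x| + |g x - h x| := by
    intro x
    by_cases h0 : f x = 0
    · have : g x - h x ≠ 0 := fun h1 => by
        have := hsum x
        exact hne x h0 (by linarith) (by linarith)
      positivity
    · positivity
  -- `|k| = 1` exactly where `f = 0`, and `k` has the sign of `g - h`.
  let k : C(X, ℝ) := ⟨fun x => (g x - h x) / (|f x| + |g x - h x|),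
    Continuous.div (by fun_prop) (by fun_prop) fun x => (hN x).ne'⟩
  have hk : ∀ x, g x - h x = k x * (|f x| + |g x - h x|) := fun x =>
    (div_mul_cancel₀ _ (hN x).ne').symm
  have hklt : |ζ k| < 1 := by
    obtain ⟨x, hx, hx'⟩ := hζ.exists_eq_and_eq k f
    have h1 := congrArg abs (hk x)
    rw [abs_mul, hx, abs_of_pos (hN x)] at h1
    have h2 : 0 < |f x| := abs_pos.2 (by rw [hx']; exact hf.ne')
    by_contra! h3
    nlinarith [abs_nonneg (g x - h x)]
  obtain ⟨e, he | he⟩ := hζ.exists_level_subset k f fun x hx hx0 => by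
    have h1 := congrArg abs (hk x)
    have h2 := hN x
    rw [abs_mul, hx, abs_of_pos (hN x)] at h1
    rw [hx0, abs_zero, zero_add] at h1 h2
    nlinarith
  -- Here `g + h = -f < 0`, so the smaller of `g`, `h` is negative; the sign of `ζ k` tells which.
  · rcases le_total 0 (ζ k) with hv | hv
    · obtain ⟨x, hx, hx'⟩ := hζ.exists_eq_and_eq e h
      obtain ⟨h1, h2⟩ := he x hx
      have h3 : 0 ≤ g x - h x := by rw [hk, h1]; exact mul_nonneg hv (hN x).le
      linarith [hsum x]
    · obtain ⟨x, hx, hx'⟩ := hζ.exists_eq_and_eq e g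
      obtain ⟨h1, h2⟩ := he x hx
      have h3 : g x - h x ≤ 0 := by
        rw [hk, h1]; exact mul_nonpos_of_nonpos_of_nonneg hv (hN x).le
      linarith [hsum x]
  · obtain ⟨x, hx, hx'⟩ := hζ.exists_eq_and_eq e f
    linarith [(he x hx).2]

lemma map_add_const [CompactSpace X] (hζ : IsSimpleQuasiState ζ) (F : C(X, ℝ)) (c : ℝ) :
    ζ (F + ContinuousMap.const X c) = ζ F + c :=
  hζ.map_eq_of_comp (φ := fun t => t + c) (by fun_prop) fun _ => rfl

/-- Three functions with sum zero and nonnegative quasi-integrals have a common zero. -/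
lemma exists_common_zero [CompactSpace X] (hζ : IsSimpleQuasiState ζ) (f g h : C(X, ℝ))
    (hsum : ∀ x, f x + g x + h x = 0) (hf : 0 ≤ ζ f) (hg : 0 ≤ ζ g) (hh : 0 ≤ ζ h) :
    ∃ x, f x = 0 ∧ g x = 0 ∧ h x = 0 := by
  set S := ζ f + ζ g + ζ h with hS
  have hS0 : 0 ≤ S := by positivity
  rcases hS0.eq_or_lt with h0 | h0
  · obtain ⟨x, hx, hx'⟩ := hζ.exists_eq_and_eq f g
    exact ⟨x, by linarith, by linarith, by linarith [hsum x]⟩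
  by_contra! hne
  obtain ⟨ε, hε, hle⟩ := exists_pos_le_of_pos
    (⟨fun x => |f x| + |g x|, by fun_prop⟩ : C(X, ℝ)) (by
      intro x
      show 0 < |f x| + |g x|
      by_cases h1 : f x = 0
      · have : g x ≠ 0 := fun h2 => hne x h1 h2 (by linarith [hsum x])
        positivity
      · positivity)
  replace hle : ∀ x, ε ≤ |f x| + |g x| := hle
  -- Shifting each value by `η` of its way to the mean `S / 3` makes all three positive; a common
  -- zero of the shifted functions has `|f| + |g| ≤ 2ηS < ε`.
  obtain ⟨η, hη, hη1, hηε⟩ : ∃ η : ℝ, 0 < η ∧ η ≤ 1 ∧ η * (2 * S) < ε := by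
    refine ⟨min 1 (ε / (4 * S)), by positivity, min_le_left _ _, ?_⟩
    calc min 1 (ε / (4 * S)) * (2 * S) ≤ ε / (4 * S) * (2 * S) := by gcongr; exact min_le_right _ _
      _ = ε / 2 := by field_simp; norm_num
      _ < ε := by linarith
  have hpos : ∀ F : C(X, ℝ), 0 ≤ ζ F →
      0 < ζ (F + ContinuousMap.const X (η * (S / 3 - ζ F))) := by
    intro F hF
    rw [hζ.map_add_const]
    nlinarith [mul_nonneg (sub_nonneg.2 hη1) hF, mul_pos hη h0]
  obtain ⟨x, h1, h2, -⟩ := hζ.exists_common_zero_of_pos _ _ _ (by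
    intro x
    simp only [ContinuousMap.add_apply, ContinuousMap.const_apply]
    linear_combination hsum x - η * hS) (hpos f hf) (hpos g hg) (hpos h hh)
  simp only [ContinuousMap.add_apply, ContinuousMap.const_apply] at h1 h2
  have hb : ∀ t, 0 ≤ t → t ≤ S → |η * (S / 3 - t)| ≤ η * S := fun t ht ht' => by
    rw [abs_mul, abs_of_pos hη]
    gcongr
    rw [abs_le]
    constructor <;> linarith
  have h3 : |f x| ≤ η * S := by
    rw [eq_neg_of_add_eq_zero_left h1, abs_neg]; exact hb _ hf (by linarith)
  have h4 : |g x| ≤ η * S := by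
    rw [eq_neg_of_add_eq_zero_left h2, abs_neg]; exact hb _ hg (by linarith)
  linarith [hle x]

/-- The image of `(F, G)` contains the triangle cut out by the lines `{x = ζ F}`, `{y = ζ G}` and
`{x + y = ζ (F + G)}`. -/
lemma exists_eq_of_barycentric [CompactSpace X] (hζ : IsSimpleQuasiState ζ) (F G : C(X, ℝ))
    {s t : ℝ} (hs : 0 ≤ s) (ht : 0 ≤ t) (hst : s + t ≤ 1) :
    ∃ x, F x = ζ F + t * (ζ (F + G) - ζ F - ζ G) ∧ G x = ζ G + s * (ζ (F + G) - ζ F - ζ G) := by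
  set d := ζ (F + G) - ζ F - ζ G with hd
  rcases eq_or_ne d 0 with h0 | h0
  · simpa [h0] using hζ.exists_eq_and_eq F G
  -- The factor `d` turns the values under `ζ` into `d²` times barycentric coordinates, nonnegative
  -- for either sign of `d`.
  let f : C(X, ℝ) := ⟨fun x => (ζ F + t * d - F x) * d, by fun_prop⟩
  let g : C(X, ℝ) := ⟨fun x => (ζ G + s * d - G x) * d, by fun_prop⟩
  let h : C(X, ℝ) := ⟨fun x => (F x + G x - (ζ F + t * d + (ζ G + s * d))) * d, by fun_prop⟩
  have hf : ζ f = t * d ^ 2 := by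
    rw [hζ.map_eq_of_comp (A := f) (H := F) (φ := fun y => (ζ F + t * d - y) * d)
      (by fun_prop) fun _ => rfl]
    ring
  have hg : ζ g = s * d ^ 2 := by
    rw [hζ.map_eq_of_comp (A := g) (H := G) (φ := fun y => (ζ G + s * d - y) * d)
      (by fun_prop) fun _ => rfl]
    ring
  have hh : ζ h = (1 - (s + t)) * d ^ 2 := by
    rw [hζ.map_eq_of_comp (A := h) (H := F + G)
      (φ := fun y => (y - (ζ F + t * d + (ζ G + s * d))) * d) (by fun_prop) fun _ => rfl]
    linear_combination -d * hd
  obtain ⟨x, h1, h2, -⟩ := hζ.exists_common_zero f g h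
    (fun x => by
      show (ζ F + t * d - F x) * d + (ζ G + s * d - G x) * d +
        (F x + G x - (ζ F + t * d + (ζ G + s * d))) * d = 0
      ring)
    (by rw [hf]; positivity) (by rw [hg]; positivity)
    (by rw [hh]; exact mul_nonneg (by linarith) (by positivity))
  have h3 : ζ F + t * d - F x = 0 := (mul_eq_zero.1 h1).resolve_right h0
  have h4 : ζ G + s * d - G x = 0 := (mul_eq_zero.1 h2).resolve_right h0
  exact ⟨x, by linarith, by linarith⟩

end IsSimpleQuasiState

/-- A closed manifold is a compact Hausdorff space with an atlas of charts in `ℝⁿ` (no boundary);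
no differentiability of the transition maps is assumed. -/
theorem theorem1p1 (n : ℕ) (M : Type*) [TopologicalSpace M] [CompactSpace M] [T2Space M]
    [ChartedSpace (EuclideanSpace ℝ (Fin n)) M]
    (ζ : C(M, ℝ) → ℝ) (hζ : IsSimpleQuasiState ζ) (F G : C(M, ℝ))
    (P Q R : EuclideanSpace ℝ (Fin 2))
    (hP : P = !₂[ζ F, ζ G])
    (hQ : Q = !₂[ζ F, ζ (F + G) - ζ F])
    (hR : R = !₂[ζ (F + G) - ζ G, ζ G]) :
    convexHull ℝ {P, Q, R} ⊆ Set.range (momentMap F G) ∧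
      ∠ Q P R = Real.pi / 2 ∧
      dist P Q = nonlinearity ζ F G ∧ dist P R = nonlinearity ζ F G := by
  refine ⟨?_, ?_, ?_, ?_⟩
  · intro z hz
    rw [convexHull_insert (by simp), convexHull_pair, mem_convexJoin] at hz
    obtain ⟨p, hp, y, ⟨a, b, ha, hb, hab, rfl⟩, ⟨u, v, hu, hv, huv, rfl⟩⟩ := hz
    obtain rfl : p = P := hp
    obtain ⟨x, hx, hx'⟩ := hζ.exists_eq_of_barycentric F G (s := v * a) (t := v * b)
      (by positivity) (by positivity) (by rw [← mul_add, hab]; linarith)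
    refine ⟨x, ?_⟩
    obtain rfl : u = 1 - v := by linarith
    obtain rfl : a = 1 - b := by linarith
    ext i
    fin_cases i
    · simp [momentMap, hP, hQ, hR, hx]
      ring
    · simp [momentMap, hP, hQ, hR, hx']
      ring
  · rw [EuclideanGeometry.angle, ← InnerProductGeometry.inner_eq_zero_iff_angle_eq_pi_div_two]
    simp [hP, hQ, hR, PiLp.inner_apply, Fin.sum_univ_two]
  · rw [EuclideanSpace.dist_eq]
    simp [hP, hQ, Fin.sum_univ_two, Real.sqrt_sq_eq_abs, Real.dist_eq, nonlinearity]
    exact abs_sub_comm _ _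
  · rw [EuclideanSpace.dist_eq]
    simp [hP, hR, Fin.sum_univ_two, Real.sqrt_sq_eq_abs, Real.dist_eq, nonlinearity]
    rw [abs_sub_comm, sub_right_comm]
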